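/- Let $A$ be a normal noetherian domain. Write $\operatorname{Div} A$ for the group of Weil divisors of $\operatorname{Spec} A$ (the free abelian group on the height-one primes of $A$) and $\operatorname{Cl} A$ for the divisor class group, that is, $\operatorname{Div} A$ modulo principal divisors. A divisor $D$ is called *coaffine* if for every effective divisor $E$ linearly equivalent to $D$ the open complement $\operatorname{Spec} A\setminus\operatorname{Supp} E$ is an affine scheme. It is *strongly coaffine* if for every $n\in\mathbb{Z}$ the divisor $nD$ is coaffine or trivial (i.e. principal). It is *affine trivial* if $D+E$ is strongly coaffine for every strongly coaffine divisor $E$. The affine trivial divisors form a subgroup of $\operatorname{Div} A$ containing the principal divisors, and the *affine class group* $\operatorname{ACl} A$ is the quotient of $\operatorname{Div} A$ by this subgroup. For a flat extension $A\to A'$ of normal noetherian domains, $p^*\colon \operatorname{Div} A\to\operatorname{Div} A'$ denotes the flat pull-back of Weil divisors: the coefficient of $p^*D$ at a height-one prime $\mathfrak q$ of $A'$ is $\operatorname{length}(A'_{\mathfrak q}/\mathfrak p A'_{\mathfrak q})$ times the coefficient of $D$ at $\mathfrak p=\mathfrak q\cap A$ if $\mathfrak p$ has height one, and $0$ otherwise.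 It induces $p^*\colon\operatorname{Cl} A\to\operatorname{Cl} A'$. **Theorem.** Let $A\to A'$ be a faithfully flat extension of normal noetherian domains such that the pull-back $p^*\colon \operatorname{Cl} A\to \operatorname{Cl} A'$ is surjective. Then $\operatorname{ACl} A=\operatorname{ACl} A'$; that is, $p^*\colon\operatorname{Div} A\to\operatorname{Div} A'$ induces an isomorphism of groups $\operatorname{ACl} A\xrightarrow{\ \sim\ }\operatorname{ACl} A'$. -/

import Mathlib

open scoped nonZeroDivisors

namespace NormalDomain

/-- The prime divisors of `Spec A`, i.e. the prime ideals of height one of `A`. -/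
@[ext]
structure PrimeDivisor (A : Type*) [CommRing A] where
  asIdeal : Ideal A
  isPrime : asIdeal.IsPrime
  height_eq_one : asIdeal.height = 1

attribute [instance] PrimeDivisor.isPrime

/-- The group `Div A` of Weil divisors of `Spec A`: finite formal integral combinations of
prime divisors. -/
abbrev WeilDivisor (A : Type*) [CommRing A] : Type _ := PrimeDivisor A →₀ ℤ

section Order

variable {A : Type*} [CommRing A]

/-- The local ring `A_p` at a prime divisor `p`. -/
abbrev PrimeDivisor.LocalRing (p : PrimeDivisor A) : Type _ := Localization.AtPrime p.asIdeal

/-- The order of vanishing of `a` along the prime divisor `p`, that is, the length of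
`A_p / a A_p`. For a normal noetherian domain this is the normalized discrete valuation
of `A_p` (for `a ≠ 0`). -/
noncomputable def PrimeDivisor.ord (p : PrimeDivisor A) (a : A) : ℕ :=
  (Ring.ord p.LocalRing (algebraMap A p.LocalRing a)).toNat

theorem PrimeDivisor.ord_eq_zero (p : PrimeDivisor A) {a : A} (ha : a ∉ p.asIdeal) :
    p.ord a = 0 := by
  have hu : IsUnit (algebraMap A p.LocalRing a) :=
    IsLocalization.map_units p.LocalRing (⟨a, ha⟩ : p.asIdeal.primeCompl)
  simp [PrimeDivisor.ord, Ring.ord_of_isUnit hu]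

theorem PrimeDivisor.krullDimLE (p : PrimeDivisor A) : Ring.KrullDimLE 1 p.LocalRing := by
  rw [Ring.KrullDimLE, Order.krullDimLE_iff]
  have h := IsLocalization.AtPrime.ringKrullDim_eq_height p.asIdeal p.LocalRing
  rw [p.height_eq_one] at h
  exact h.le

theorem PrimeDivisor.mem_minimalPrimes (p : PrimeDivisor A) [IsDomain A] [IsNoetherianRing A]
    {I : Ideal A} (hI : I ≠ ⊥) (h : I ≤ p.asIdeal) : p.asIdeal ∈ I.minimalPrimes := by
  apply Ideal.mem_minimalPrimes_of_height_le h
  rw [p.height_eq_one, Order.one_le_iff_ne_zero]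
  exact fun h0 => hI (Ideal.height_eq_zero_iff_eq_bot.mp h0)

theorem PrimeDivisor.finite_setOf_le [IsDomain A] [IsNoetherianRing A]
    {I : Ideal A} (hI : I ≠ ⊥) : {p : PrimeDivisor A | I ≤ p.asIdeal}.Finite := by
  refine Set.Finite.of_finite_image
    ((Ideal.finite_minimalPrimes_of_isNoetherianRing A I).subset ?_)
    (f := PrimeDivisor.asIdeal) (fun p _ q _ h => PrimeDivisor.ext h)
  rintro _ ⟨p, hp, rfl⟩
  exact p.mem_minimalPrimes hI hp

variable [IsDomain A]

theorem PrimeDivisor.algebraMap_mem (p : PrimeDivisor A) (a : A⁰) :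
    algebraMap A p.LocalRing a ∈ p.LocalRing⁰ := by
  apply mem_nonZeroDivisors_of_ne_zero
  intro h
  apply nonZeroDivisors.coe_ne_zero a
  exact IsLocalization.injective p.LocalRing p.asIdeal.primeCompl_le_nonZeroDivisors
    (h.trans (map_zero _).symm)

variable [IsNoetherianRing A]

theorem PrimeDivisor.ord_mul (p : PrimeDivisor A) (a b : A⁰) :
    p.ord (a * b) = p.ord a + p.ord b := by
  have := p.krullDimLE
  simp only [PrimeDivisor.ord, map_mul]
  rw [Ring.ord_mul _ (p.algebraMap_mem b), ENat.toNat_add]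
  · exact Ring.ord_ne_top (p.algebraMap_mem a)
  · exact Ring.ord_ne_top (p.algebraMap_mem b)

end Order

section Divisors

variable (A : Type*) [CommRing A] [IsDomain A] [IsNoetherianRing A]

variable {A} in
/-- The divisor `div(a) = ∑ ord_p(a) p` of a nonzero element `a` of `A`. -/
noncomputable def divisorOf (a : A⁰) : WeilDivisor A :=
  Finsupp.ofSupportFinite (fun p => (p.ord a : ℤ)) <| by
    have hI : Ideal.span {(a : A)} ≠ ⊥ := by
      simp
    refine (PrimeDivisor.finite_setOf_le hI).subset fun p hp => ?_
    by_contra hn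
    apply hp
    have : (a : A) ∉ p.asIdeal := fun h => hn ((Ideal.span_singleton_le_iff_mem _).mpr h)
    simp [p.ord_eq_zero this]

@[simp]
theorem divisorOf_apply (a : A⁰) (p : PrimeDivisor A) : divisorOf a p = p.ord a := rfl

theorem divisorOf_mul (a b : A⁰) : divisorOf (a * b) = divisorOf a + divisorOf b := by
  ext p
  simp [p.ord_mul]

theorem divisorOf_one : divisorOf (1 : A⁰) = 0 := by
  have h := divisorOf_mul A 1 1
  rw [mul_one] at h
  simpa using h

/-- The subgroup of principal divisors: the divisors `div(a) - div(b)` of the nonzero elements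
`a / b` of the fraction field of `A`. -/
noncomputable def principalDivisors : AddSubgroup (WeilDivisor A) where
  carrier := {D | ∃ a b : A⁰, D = divisorOf a - divisorOf b}
  zero_mem' := ⟨1, 1, by simp⟩
  add_mem' := by
    rintro _ _ ⟨a, b, rfl⟩ ⟨c, d, rfl⟩
    refine ⟨a * c, b * d, ?_⟩
    rw [divisorOf_mul, divisorOf_mul]
    abel
  neg_mem' := by
    rintro _ ⟨a, b, rfl⟩
    exact ⟨b, a, by abel⟩

/-- The divisor class group `Cl A`. -/
abbrev Cl : Type _ := WeilDivisor A ⧸ principalDivisors A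

variable {A}

/-- Linear equivalence of divisors. -/
def LinearlyEquivalent (D E : WeilDivisor A) : Prop := D - E ∈ principalDivisors A

end Divisors

section Coaffine

open AlgebraicGeometry

/-- The support `⋃ V(p)`, over the primes `p` occurring in `D`, as a subset of `Spec A`. -/
def supportSet {A : Type*} [CommRing A] (D : WeilDivisor A) : Set (PrimeSpectrum A) :=
  ⋃ p ∈ D.support, PrimeSpectrum.zeroLocus (p.asIdeal : Set A)

theorem isClosed_supportSet {A : Type*} [CommRing A] (D : WeilDivisor A) :
    IsClosed (supportSet D) :=
  isClosed_biUnion_finset fun _ _ => PrimeSpectrum.isClosed_zeroLocus _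

/-- The complement of (the support of) a divisor, as an open subset of the scheme `Spec A`. -/
def complement {A : Type*} [CommRing A] (D : WeilDivisor A) : (Spec (CommRingCat.of A)).Opens :=
  ⟨(supportSet D)ᶜ, (isClosed_supportSet D).isOpen_compl⟩

variable {A : Type*} [CommRing A] [IsDomain A] [IsNoetherianRing A]

/-- `D` is coaffine if every effective divisor linearly equivalent to `D` has affine
complement. -/
def IsCoaffine (D : WeilDivisor A) : Prop :=
  ∀ E : WeilDivisor A, 0 ≤ E → LinearlyEquivalent E D → IsAffineOpen (complement E)

/-- `D` is strongly coaffine if every multiple `nD`, `n ∈ ℤ`, is coaffine or trivial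
(in the divisor class group). -/
def IsStronglyCoaffine (D : WeilDivisor A) : Prop :=
  ∀ n : ℤ, IsCoaffine (n • D) ∨ n • D ∈ principalDivisors A

/-- `D` is affine trivial if `D + E` is strongly coaffine for every strongly coaffine `E`. -/
def IsAffineTrivial (D : WeilDivisor A) : Prop :=
  ∀ E : WeilDivisor A, IsStronglyCoaffine E → IsStronglyCoaffine (D + E)

theorem IsStronglyCoaffine.neg {D : WeilDivisor A} (h : IsStronglyCoaffine D) :
    IsStronglyCoaffine (-D) := fun n => by
  simpa using h (-n)

variable (A) in
/-- The subgroup of affine trivial divisors. -/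
def affineTrivialDivisors : AddSubgroup (WeilDivisor A) where
  carrier := {D | IsAffineTrivial D}
  zero_mem' := fun E hE => by simpa using hE
  add_mem' := fun {D D'} hD hD' E hE => by
    rw [add_assoc]
    exact hD _ (hD' E hE)
  neg_mem' := fun {D} hD E hE => by
    have h := (hD (-E) hE.neg).neg
    simpa [add_comm] using h

variable (A) in
/-- The affine class group `ACl A`: divisors modulo affine trivial divisors. -/
abbrev ACl : Type _ := WeilDivisor A ⧸ affineTrivialDivisors A

end Coaffine

section Pullback

variable (A B : Type*) [CommRing A] [CommRing B] [Algebra A B]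

variable {A B} in
open Classical in
/-- The coefficient at `q` of the flat pull-back of `D`: if `p = q ∩ A` has height one, it is the
coefficient of `D` at `p` times the ramification index, the length of `B_q / p B_q`. -/
noncomputable def pullbackCoeff (D : WeilDivisor A) (q : PrimeDivisor B) : ℤ :=
  if h : (q.asIdeal.under A).height = 1 then
    (q.asIdeal.ramificationIdx A : ℤ) * D ⟨q.asIdeal.under A, inferInstance, h⟩
  else 0

variable [IsDomain A] [IsDomain B] [Module.Flat A B]

theorem algebraMap_injective_of_flat : Function.Injective (algebraMap A B) :=
  FaithfulSMul.algebraMap_injective A B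

variable [IsNoetherianRing B]

variable {A B} in
theorem finite_support_pullbackCoeff (D : WeilDivisor A) :
    (Function.support (pullbackCoeff (B := B) D)).Finite := by
  have hfin : (⋃ p ∈ D.support,
      {q : PrimeDivisor B | p.asIdeal.map (algebraMap A B) ≤ q.asIdeal}).Finite := by
    refine Set.Finite.biUnion D.support.finite_toSet fun p _ => ?_
    apply PrimeDivisor.finite_setOf_le
    rw [Ne, Ideal.map_eq_bot_iff_of_injective (algebraMap_injective_of_flat A B)]
    exact Ideal.ne_bot_of_height_eq_one p.height_eq_one
  refine hfin.subset fun q hq => ?_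
  by_cases h : (q.asIdeal.under A).height = 1
  · simp only [Function.mem_support, pullbackCoeff, h, dite_true] at hq
    simp only [Set.mem_iUnion]
    exact ⟨⟨q.asIdeal.under A, inferInstance, h⟩,
      Finsupp.mem_support_iff.mpr (right_ne_zero_of_mul hq), Ideal.map_comap_le⟩
  · simp [pullbackCoeff, h] at hq

/-- The pull-back `Div A → Div B` of Weil divisors along a flat extension `A → B`. -/
noncomputable def pullbackDiv : WeilDivisor A →+ WeilDivisor B where
  toFun D := Finsupp.ofSupportFinite (pullbackCoeff D) (finite_support_pullbackCoeff D)
  map_zero' := by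
    ext q
    simp [Finsupp.ofSupportFinite_coe, pullbackCoeff]
  map_add' D E := by
    ext q
    by_cases h : (q.asIdeal.under A).height = 1 <;>
      simp [Finsupp.ofSupportFinite_coe, pullbackCoeff, h, mul_add]

theorem pullbackDiv_apply (D : WeilDivisor A) (q : PrimeDivisor B) :
    pullbackDiv A B D q = pullbackCoeff D q := rfl

variable [IsNoetherianRing A] [IsIntegrallyClosed A]

/-- `A_p` is a discrete valuation ring for a prime divisor `p` of a normal noetherian domain. -/
theorem PrimeDivisor.isDiscreteValuationRing (p : PrimeDivisor A) :
    IsDiscreteValuationRing p.LocalRing := by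
  have := p.krullDimLE
  have hle := p.asIdeal.primeCompl_le_nonZeroDivisors
  have : IsDomain p.LocalRing := IsLocalization.isDomain_localization hle
  have : IsNoetherianRing p.LocalRing :=
    IsLocalization.isNoetherianRing p.asIdeal.primeCompl _ inferInstance
  have : IsIntegrallyClosed p.LocalRing :=
    isIntegrallyClosed_of_isLocalization _ p.asIdeal.primeCompl hle
  have hdim := IsLocalization.AtPrime.ringKrullDim_eq_height p.asIdeal p.LocalRing
  rw [p.height_eq_one] at hdim
  have hf : ¬ IsField p.LocalRing := fun h => by
    rw [ringKrullDim_eq_zero_of_isField h] at hdim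
    exact absurd hdim (by decide)
  have : Ring.DimensionLEOne p.LocalRing := ⟨fun {P} hP hPp => by
    have hm := IsLocalRing.maximalIdeal_height_eq_ringKrullDim (R := p.LocalRing)
    rw [hdim] at hm
    have hm1 : (IsLocalRing.maximalIdeal p.LocalRing).height = 1 := by exact_mod_cast hm
    have hP1 : 1 ≤ P.height := Order.one_le_iff_ne_zero.mpr
      fun h0 => hP (Ideal.height_eq_zero_iff_eq_bot.mp h0)
    have hPm : P = IsLocalRing.maximalIdeal p.LocalRing :=
      Ideal.eq_of_le_of_height_le _ (IsLocalRing.le_maximalIdeal hPp.ne_top) (hm1.trans_le hP1)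
    rw [hPm]
    infer_instance⟩
  have hded : IsDedekindDomain p.LocalRing := { }
  exact ((IsDiscreteValuationRing.TFAE p.LocalRing hf).out 2 0).mp hded

theorem PrimeDivisor.ord_algebraMap (q : PrimeDivisor B)
    (h : (q.asIdeal.under A).height = 1) (a : A⁰) :
    q.ord (algebraMap A B a) = q.asIdeal.ramificationIdx A *
      (⟨q.asIdeal.under A, inferInstance, h⟩ : PrimeDivisor A).ord a := by
  set p : PrimeDivisor A := ⟨q.asIdeal.under A, inferInstance, h⟩ with hp
  have := p.isDiscreteValuationRing
  have := q.krullDimLE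
  have : IsDomain q.LocalRing :=
    IsLocalization.isDomain_localization q.asIdeal.primeCompl_le_nonZeroDivisors
  have : IsNoetherianRing q.LocalRing :=
    IsLocalization.isNoetherianRing q.asIdeal.primeCompl _ inferInstance
  let f : p.LocalRing →+* q.LocalRing :=
    Localization.localRingHom p.asIdeal q.asIdeal (algebraMap A B) rfl
  have hf : ∀ x : A, f (algebraMap A p.LocalRing x) = algebraMap A q.LocalRing x := fun x => by
    rw [IsScalarTower.algebraMap_apply A B q.LocalRing]
    exact Localization.localRingHom_to_map ..
  have hfc : f.comp (algebraMap A p.LocalRing) = algebraMap A q.LocalRing := RingHom.ext hf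
  obtain ⟨ϖ, hϖ⟩ := IsDiscreteValuationRing.exists_irreducible p.LocalRing
  have ha : algebraMap A p.LocalRing a ≠ 0 := nonZeroDivisors.ne_zero (p.algebraMap_mem a)
  obtain ⟨n, u, hu⟩ := IsDiscreteValuationRing.eq_unit_mul_pow_irreducible ha hϖ
  have hinj : Function.Injective (algebraMap A q.LocalRing) := by
    rw [IsScalarTower.algebraMap_eq A B q.LocalRing]
    exact (IsLocalization.injective q.LocalRing
      q.asIdeal.primeCompl_le_nonZeroDivisors).comp (algebraMap_injective_of_flat A B)
  have hfϖ : f ϖ ≠ 0 := fun h0 => by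
    obtain ⟨⟨x, s⟩, hx⟩ := IsLocalization.surj p.asIdeal.primeCompl ϖ
    have h1 := congrArg f hx
    rw [map_mul, h0, zero_mul, hf] at h1
    have hx0 : x = 0 := hinj (h1.symm.trans (map_zero _).symm)
    rw [hx0, map_zero] at hx
    rcases mul_eq_zero.mp hx with h2 | h2
    · exact hϖ.ne_zero h2
    · exact (IsLocalization.map_units p.LocalRing s).ne_zero h2
  have hram : q.asIdeal.ramificationIdx A = (Ring.ord q.LocalRing (f ϖ)).toNat := by
    rw [Ideal.ramificationIdx_def, Ring.ord]
    have : (q.asIdeal.under A).map (algebraMap A q.LocalRing) = Ideal.span {f ϖ} := by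
      rw [← hfc, ← Ideal.map_map]
      have h1 : (q.asIdeal.under A).map (algebraMap A p.LocalRing) = Ideal.span {ϖ} := by
        rw [← hϖ.maximalIdeal_eq]
        exact Localization.AtPrime.map_eq_maximalIdeal
      rw [h1, Ideal.map_span, Set.image_singleton]
    rw [this]
  have hordp : p.ord a = n := by
    rw [PrimeDivisor.ord, hu, Ring.ord_mul_of_isUnit_left u.isUnit,
      Ring.ord_pow (mem_nonZeroDivisors_of_ne_zero hϖ.ne_zero), Ring.ord_of_irreducible hϖ]
    simp
  have hmem : f ϖ ∈ q.LocalRing⁰ := mem_nonZeroDivisors_of_ne_zero hfϖ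
  rw [hordp, hram, PrimeDivisor.ord, ← IsScalarTower.algebraMap_apply, ← hf, hu, map_mul, map_pow,
    Ring.ord_mul_of_isUnit_left (u.isUnit.map f), Ring.ord_pow hmem, nsmul_eq_mul,
    ENat.toNat_mul, ENat.toNat_natCast, mul_comm]

theorem pullbackDiv_divisorOf (a : A⁰) :
    pullbackDiv A B (divisorOf a) = divisorOf (⟨algebraMap A B a,
      map_mem_nonZeroDivisors _ (algebraMap_injective_of_flat A B) a.2⟩ : B⁰) := by
  ext q
  rw [pullbackDiv_apply, divisorOf_apply]
  by_cases h : (q.asIdeal.under A).height = 1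
  · rw [q.ord_algebraMap A B h a]
    simp [pullbackCoeff, h]
  · have hle : (q.asIdeal.under A).height ≤ q.asIdeal.height := by
      rw [Ideal.height_eq_height_add_of_liesOver_of_hasGoingDown (q.asIdeal.under A) q.asIdeal]
      exact le_self_add
    rw [q.height_eq_one] at hle
    have h0 : (q.asIdeal.under A).height = 0 := by
      by_contra h1
      exact h (le_antisymm hle (Order.one_le_iff_ne_zero.mpr h1))
    rw [Ideal.height_eq_zero_iff_eq_bot] at h0
    have hna : algebraMap A B a ∉ q.asIdeal := fun hm => by
      have : (a : A) ∈ q.asIdeal.under A := hm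
      rw [h0] at this
      exact nonZeroDivisors.coe_ne_zero a this
    simp [pullbackCoeff, h, q.ord_eq_zero hna]

theorem principalDivisors_le_comap :
    principalDivisors A ≤ (principalDivisors B).comap (pullbackDiv A B) := by
  rintro _ ⟨a, b, rfl⟩
  exact ⟨_, _, by rw [map_sub, pullbackDiv_divisorOf, pullbackDiv_divisorOf]⟩

/-- The pull-back `p^* : Cl A → Cl B` of divisor classes along a flat extension `A → B`. -/
noncomputable def pullbackCl : Cl A →+ Cl B :=
  QuotientAddGroup.map _ _ (pullbackDiv A B) (principalDivisors_le_comap A B)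

end Pullback

end NormalDomain

/-!
The point is that coaffineness of a divisor can be tested on generators of its module of sections,
and therefore both ascends and descends along a faithfully flat extension.

For a divisor `D`, consider the graded ring `R = ⨁ 𝒪(nD)`, `n ∈ ℤ`. A nonzero section `s ∈ R₁`
has an effective divisor of zeros `E`, and every effective divisor linearly equivalent to `D`
arises in this way. The complement `U` of `E` is affine if and only if the functions vanishing
along `E` generate the unit ideal of `Γ(U, 𝒪)`. These functions are the products of `s` with
elements of `R₋₁`, and every section over `U` has the form `x / s ^ n` with `x ∈ Rₙ`. So `U` is
affine if and only if `s` lies in the radical of the ideal of `R` generated by `R₋₁`, and `D` is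
coaffine if and only if `R₁` is contained in this radical. Replacing `D` by `-F` with `F` effective,
and `𝒪(F)` by the divisorial ideal of `div d - F`, one obtains a statement about divisorial ideals
of `A` (`isAffineOpen_complement_iff`, `isCoaffine_neg_iff`).

Divisorial ideals commute with flat base change, because they are colon ideals of principal ideals
by finitely generated ones (`divisorialIdeal_pullbackDiv`). Hence the module of sections of `p^*D`
is generated by that of `D`. As a radical is closed under linear combinations, coaffineness
ascends; as `I A' ∩ A = I` for ideals `I` of `A`, it descends (`isCoaffine_pullbackDiv_iff`).

A principal divisor is coaffine, so `D` is strongly coaffine if and only if all its multiples are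
coaffine, and this holds for `D` if and only if it holds for `p^*D`. Since these notions depend only
on the divisor class and `p^*` is surjective on classes, `D` is affine trivial if and only if
`p^*D` is (`isAffineTrivial_pullbackDiv_iff`), which gives the isomorphism.
-/

namespace NormalDomain

/-! ### Divisorial ideals of a normal noetherian domain -/

section Ideals

variable {A : Type*} [CommRing A]

/-- The divisorial ideal of functions `x` with `div x ≥ E`: the elements which, for every prime
divisor `p`, lie in the symbolic power of `p` of exponent `E p`. Negative coefficients of `E`
impose no condition. -/
noncomputable def divisorialIdeal (E : WeilDivisor A) : Ideal A :=
  ⨅ p : PrimeDivisor A,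
    (IsLocalRing.maximalIdeal p.LocalRing ^ (E p).toNat).comap (algebraMap A p.LocalRing)

theorem divisorialIdeal_zero : divisorialIdeal (0 : WeilDivisor A) = ⊤ := by
  simp [divisorialIdeal]

/-- If a prime `P` contains no prime divisor at which `E` has a positive coefficient, some function
in the divisorial ideal of `E` does not vanish at `P`. -/
theorem exists_mem_divisorialIdeal_notMem {E : WeilDivisor A} (P : Ideal A) [hP : P.IsPrime]
    (h : ∀ p : PrimeDivisor A, 0 < E p → ¬ p.asIdeal ≤ P) :
    ∃ b ∈ divisorialIdeal E, b ∉ P := by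
  have hx : ∀ p : PrimeDivisor A, ∃ x : A, x ∉ P ∧ (0 < E p → x ∈ p.asIdeal) := fun p => by
    by_cases hp : 0 < E p
    · obtain ⟨x, hx, hxP⟩ := Set.not_subset.mp (h p hp)
      exact ⟨x, hxP, fun _ => hx⟩
    · exact ⟨1, hP.one_notMem, fun h => absurd h hp⟩
  choose x hxP hxp using hx
  refine ⟨∏ p ∈ E.support, x p ^ (E p).toNat, ?_, ?_⟩
  · rw [divisorialIdeal, Submodule.mem_iInf]
    intro q
    by_cases hq : 0 < E q
    · have hdvd : x q ^ (E q).toNat ∣ ∏ p ∈ E.support, x p ^ (E p).toNat :=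
        Finset.dvd_prod_of_mem (fun p => x p ^ (E p).toNat)
          (Finsupp.mem_support_iff.mpr hq.ne')
      refine Ideal.mem_of_dvd _ hdvd ?_
      rw [Ideal.mem_comap, map_pow]
      refine Ideal.pow_mem_pow ?_ _
      rw [IsLocalization.AtPrime.to_map_mem_maximal_iff q.LocalRing q.asIdeal]
      exact hxp q hq
    · rw [Int.toNat_of_nonpos (not_lt.mp hq)]
      simp
  · rw [hP.prod_mem_iff]
    rintro ⟨p, _, hp⟩
    exact hxP p (hP.mem_of_pow_mem _ hp)

theorem PrimeDivisor.eq_of_le [IsNoetherianRing A] {p q : PrimeDivisor A}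
    (h : p.asIdeal ≤ q.asIdeal) : p = q := by
  have : p.asIdeal.FiniteHeight := inferInstance
  exact PrimeDivisor.ext (Ideal.eq_of_le_of_height_le _ h
    (by rw [p.height_eq_one, q.height_eq_one]))

variable [IsDomain A] [IsNoetherianRing A]

theorem divisorOf_nonneg (a : A⁰) : 0 ≤ divisorOf a := fun p => by simp

theorem divisorOf_pow (a : A⁰) (n : ℕ) : divisorOf (a ^ n) = n • divisorOf a := by
  induction n with
  | zero => rw [pow_zero, zero_smul]; exact divisorOf_one A
  | succ n ih => rw [pow_succ, divisorOf_mul, ih, succ_nsmul]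

variable [IsIntegrallyClosed A]

/-- The order along `p` is the valuation of the discrete valuation ring `A_p`. -/
theorem PrimeDivisor.le_ord_iff (p : PrimeDivisor A) (a : A⁰) (n : ℕ) :
    n ≤ p.ord a ↔
      algebraMap A p.LocalRing a ∈ IsLocalRing.maximalIdeal p.LocalRing ^ n := by
  have : IsDomain p.LocalRing :=
    IsLocalization.isDomain_localization p.asIdeal.primeCompl_le_nonZeroDivisors
  have := p.isDiscreteValuationRing
  have := p.krullDimLE
  obtain ⟨ϖ, hϖ⟩ := IsDiscreteValuationRing.exists_irreducible p.LocalRing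
  have ha : algebraMap A p.LocalRing a ≠ 0 := nonZeroDivisors.ne_zero (p.algebraMap_mem a)
  obtain ⟨k, u, hu⟩ := IsDiscreteValuationRing.eq_unit_mul_pow_irreducible ha hϖ
  have hord : p.ord a = k := by
    rw [PrimeDivisor.ord, hu, Ring.ord_mul_of_isUnit_left u.isUnit,
      Ring.ord_pow (mem_nonZeroDivisors_of_ne_zero hϖ.ne_zero), Ring.ord_of_irreducible hϖ]
    simp
  rw [hord, hϖ.maximalIdeal_eq, Ideal.span_singleton_pow, Ideal.mem_span_singleton, hu,
    Units.dvd_mul_left, pow_dvd_pow_iff hϖ.ne_zero hϖ.not_isUnit]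

theorem PrimeDivisor.ord_pos_iff (p : PrimeDivisor A) (a : A⁰) :
    0 < p.ord a ↔ (a : A) ∈ p.asIdeal := by
  have := p.le_ord_iff a 1
  rw [pow_one, IsLocalization.AtPrime.to_map_mem_maximal_iff p.LocalRing p.asIdeal] at this
  exact this

theorem PrimeDivisor.exists_ord_eq_one (p : PrimeDivisor A) : ∃ a : A⁰, p.ord a = 1 := by
  have : IsDomain p.LocalRing :=
    IsLocalization.isDomain_localization p.asIdeal.primeCompl_le_nonZeroDivisors
  have := p.isDiscreteValuationRing
  obtain ⟨ϖ, hϖ⟩ := IsDiscreteValuationRing.exists_irreducible p.LocalRing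
  obtain ⟨⟨x, s⟩, hx⟩ := IsLocalization.surj p.asIdeal.primeCompl ϖ
  have hs := IsLocalization.map_units p.LocalRing s
  have hirr : Irreducible (algebraMap A p.LocalRing x) := by
    have h : Associated ϖ (algebraMap A p.LocalRing x) := ⟨hs.unit, hx⟩
    exact h.irreducible hϖ
  have hx0 : x ≠ 0 := fun h => hirr.ne_zero (by rw [h, map_zero])
  refine ⟨⟨x, mem_nonZeroDivisors_of_ne_zero hx0⟩, ?_⟩
  rw [PrimeDivisor.ord, Ring.ord_of_irreducible hirr, ENat.toNat_one]

theorem coe_mem_divisorialIdeal {E : WeilDivisor A} {a : A⁰} :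
    (a : A) ∈ divisorialIdeal E ↔ E ≤ divisorOf a := by
  rw [divisorialIdeal, Submodule.mem_iInf, Finsupp.le_def]
  refine forall_congr' fun p => ?_
  rw [Ideal.mem_comap, ← p.le_ord_iff, divisorOf_apply]
  omega

theorem mem_divisorialIdeal_iff {E : WeilDivisor A} {x : A} (hx : x ≠ 0) :
    x ∈ divisorialIdeal E ↔ E ≤ divisorOf ⟨x, mem_nonZeroDivisors_of_ne_zero hx⟩ :=
  coe_mem_divisorialIdeal (a := ⟨x, mem_nonZeroDivisors_of_ne_zero hx⟩)

theorem divisorialIdeal_anti {E F : WeilDivisor A} (h : E ≤ F) :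
    divisorialIdeal F ≤ divisorialIdeal E := fun x hx => by
  rcases eq_or_ne x 0 with rfl | hx0
  · exact zero_mem _
  · rw [mem_divisorialIdeal_iff hx0] at hx ⊢
    exact h.trans hx

theorem mul_mem_divisorialIdeal {E F : WeilDivisor A} {x y : A} (hx : x ∈ divisorialIdeal E)
    (hy : y ∈ divisorialIdeal F) : x * y ∈ divisorialIdeal (E + F) := by
  rcases eq_or_ne x 0 with rfl | hx0
  · simp
  rcases eq_or_ne y 0 with rfl | hy0
  · simp
  rw [mem_divisorialIdeal_iff hx0] at hx
  rw [mem_divisorialIdeal_iff hy0] at hy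
  have := coe_mem_divisorialIdeal.mpr ((add_le_add hx hy).trans_eq (divisorOf_mul A _ _).symm)
  exact this

theorem pow_mem_divisorialIdeal {E : WeilDivisor A} {x : A} (hx : x ∈ divisorialIdeal E)
    (n : ℕ) : x ^ n ∈ divisorialIdeal (n • E) := by
  induction n with
  | zero => simp [divisorialIdeal_zero]
  | succ n ih => rw [pow_succ, succ_nsmul]; exact mul_mem_divisorialIdeal ih hx

theorem mul_mem_divisorialIdeal_mul {F : WeilDivisor A} {J : Ideal A} {m n : ℕ} {x z : A}
    (hx : x ∈ divisorialIdeal (m • F)) (hz : z ∈ divisorialIdeal (n • F) * J) :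
    x * z ∈ divisorialIdeal ((m + n) • F) * J := by
  have h := Ideal.mul_mem_mul hx hz
  rw [← mul_assoc] at h
  refine Ideal.mul_mono_left (Ideal.mul_le.mpr fun a ha b hb => ?_) h
  rw [add_smul]
  exact mul_mem_divisorialIdeal ha hb

theorem exists_ne_zero_mem_divisorialIdeal (E : WeilDivisor A) :
    ∃ a : A⁰, E ≤ divisorOf a := by
  obtain ⟨b, hb, hb0⟩ := exists_mem_divisorialIdeal_notMem (E := E) (⊥ : Ideal A) fun p _ hp => by
    have := Ideal.ne_bot_of_height_eq_one p.height_eq_one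
    exact this (le_bot_iff.mp hp)
  exact ⟨_, (mem_divisorialIdeal_iff hb0).mp hb⟩

/-- Some function with divisor at least `E` has the least order along `p` that `E` allows. -/
theorem exists_ord_eq {E : WeilDivisor A} (hE : 0 ≤ E) (p : PrimeDivisor A) :
    ∃ a : A⁰, E ≤ divisorOf a ∧ divisorOf a p = E p := by
  classical
  obtain ⟨t, ht⟩ := p.exists_ord_eq_one
  obtain ⟨b, hb, hbp⟩ := exists_mem_divisorialIdeal_notMem (E := E.erase p) p.asIdeal
    fun q hq hle => by
      rw [PrimeDivisor.eq_of_le hle, Finsupp.erase_same] at hq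
      exact lt_irrefl _ hq
  have hb0 : b ≠ 0 := fun h => hbp (h ▸ zero_mem _)
  rw [mem_divisorialIdeal_iff hb0] at hb
  have hbp0 := p.ord_eq_zero hbp
  have hEp : ((E p).toNat : ℤ) = E p := Int.toNat_of_nonneg (hE p)
  refine ⟨t ^ (E p).toNat * ⟨b, mem_nonZeroDivisors_of_ne_zero hb0⟩, ?_, ?_⟩
  · intro q
    rw [divisorOf_mul, divisorOf_pow]
    by_cases hq : q = p
    · subst hq
      simp [hEp, ht]
    · have := hb q
      rw [Finsupp.erase_ne hq] at this
      simp only [Finsupp.add_apply, Finsupp.smul_apply, divisorOf_apply] at this ⊢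
      exact this.trans (le_add_of_nonneg_left (by positivity))
  · rw [divisorOf_mul, divisorOf_pow]
    simp [hEp, ht, hbp0]

/-- A normal noetherian domain is the intersection of its localizations at the primes of height
one. An associated prime `P` of `A / b` has height one: write `P = (b) : c`. If `(c / b) P ⊆ P`,
then `c / b` is integral over `A`, hence in `A`; otherwise `P` is principal after localization. -/
theorem dvd_iff_divisorOf_le {a b : A⁰} : (b : A) ∣ a ↔ divisorOf b ≤ divisorOf a := by
  constructor
  · rintro ⟨c, hc⟩
    have hc0 : c ≠ 0 := by
      rintro rfl
      exact nonZeroDivisors.coe_ne_zero a (hc.trans (mul_zero _))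
    have : a = b * ⟨c, mem_nonZeroDivisors_of_ne_zero hc0⟩ := Subtype.ext hc
    rw [this, divisorOf_mul]
    exact le_add_of_nonneg_right (divisorOf_nonneg _)
  intro h
  by_contra hdvd
  let I : Ideal A := Ideal.span {(b : A)}
  have hb0 : (b : A) ≠ 0 := nonZeroDivisors.coe_ne_zero b
  have ha : (Ideal.Quotient.mk I (a : A)) ≠ 0 := by
    rwa [Ne, Ideal.Quotient.eq_zero_iff_mem, Ideal.mem_span_singleton]
  obtain ⟨P, hPass, haP⟩ :=
    exists_le_isAssociatedPrime_of_isNoetherianRing A (Ideal.Quotient.mk I (a : A)) ha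
  rw [isAssociatedPrime_iff] at hPass
  obtain ⟨hPp, c', hc'⟩ := hPass
  obtain ⟨c, rfl⟩ := Ideal.Quotient.mk_surjective c'
  have hmem : ∀ d y : A, y ∈ (⊥ : Submodule A (A ⧸ I)).colon {Ideal.Quotient.mk I d} ↔
      (b : A) ∣ d * y := fun d y => by
    rw [Submodule.mem_colon_singleton, Submodule.mem_bot, ← Ideal.mem_span_singleton,
      ← Ideal.Quotient.eq_zero_iff_mem, map_mul, mul_comm, Algebra.smul_def]
    rfl
  have hP : ∀ y, y ∈ P ↔ (b : A) ∣ c * y := fun y => by rw [hc', hmem]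
  have hbP : (b : A) ∈ P := (hP b).mpr (dvd_mul_left _ _)
  -- Some multiple of `c / b` by an element of `P` is a unit at `P`.
  have key : ∃ x ∈ P, ∃ y ∉ P, c * x = b * y := by
    by_contra! hcon
    let K := FractionRing A
    have hbK : algebraMap A K b ≠ 0 := by simp
    have hint : IsIntegral A (algebraMap A K c / algebraMap A K b) := by
      refine isIntegral_of_smul_mem_submodule (M := K)
        (Submodule.map (Algebra.linearMap A K) P) ?_ ?_ _ ?_
      · intro h0
        have : algebraMap A K b ∈ Submodule.map (Algebra.linearMap A K) P :=
          ⟨b, hbP, rfl⟩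
        rw [h0] at this
        exact hbK this
      · exact (IsNoetherian.noetherian P).map _
      · rintro _ ⟨x, hx, rfl⟩
        obtain ⟨y, hy⟩ := (hP x).mp hx
        refine ⟨y, by_contra fun hyP => hcon x hx y hyP hy, ?_⟩
        simp only [Algebra.linearMap_apply, smul_eq_mul]
        rw [div_mul_eq_mul_div, eq_div_iff hbK, ← map_mul, ← map_mul, hy, mul_comm]
    obtain ⟨z, hz⟩ := IsIntegrallyClosed.isIntegral_iff.mp hint
    rw [eq_div_iff hbK, ← map_mul] at hz
    have hz' : z * b = c := IsFractionRing.injective A K hz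
    apply hPp.one_notMem
    rw [hP, mul_one, ← hz']
    exact dvd_mul_left _ _
  obtain ⟨x, hxP, y, hyP, hxy⟩ := key
  have hz : ∀ z ∈ P, x ∣ y * z := fun z hz => by
    obtain ⟨w, hw⟩ := (hP z).mp hz
    refine ⟨w, mul_left_cancel₀ hb0 ?_⟩
    linear_combination (-z) * hxy + x * hw
  have hmin : P ∈ (Ideal.span {x}).minimalPrimes := by
    refine ⟨⟨hPp, (Ideal.span_singleton_le_iff_mem _).mpr hxP⟩, ?_⟩
    rintro Q ⟨hQ, hxQ⟩ hQP z hzP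
    have : y * z ∈ Q := Q.mem_of_dvd (hz z hzP) ((Ideal.span_singleton_le_iff_mem _).mp hxQ)
    exact (hQ.mem_or_mem this).resolve_left fun hyQ => hyP (hQP hyQ)
  have hle : P.height ≤ 1 := Ideal.height_le_one_of_isPrincipal_of_mem_minimalPrimes _ P hmin
  have hne : P.height ≠ 0 := fun h0 => by
    rw [Ideal.height_eq_zero_iff_eq_bot] at h0
    rw [h0] at hbP
    exact hb0 hbP
  let p : PrimeDivisor A := ⟨P, hPp, le_antisymm hle (Order.one_le_iff_ne_zero.mpr hne)⟩
  have : IsDomain p.LocalRing :=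
    IsLocalization.isDomain_localization p.asIdeal.primeCompl_le_nonZeroDivisors
  have := p.isDiscreteValuationRing
  -- At the discrete valuation ring `A_P` the order decides divisibility.
  have hloc : algebraMap A p.LocalRing b ∣ algebraMap A p.LocalRing a := by
    obtain ⟨ϖ, hϖ⟩ := IsDiscreteValuationRing.exists_irreducible p.LocalRing
    have hbn : algebraMap A p.LocalRing b ≠ 0 := nonZeroDivisors.ne_zero (p.algebraMap_mem b)
    obtain ⟨k, hk⟩ := IsDiscreteValuationRing.associated_pow_irreducible hbn hϖ
    have h1 : ∀ n, (n ≤ p.ord b ↔ ϖ ^ n ∣ algebraMap A p.LocalRing b) := fun n => by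
      rw [p.le_ord_iff, hϖ.maximalIdeal_eq, Ideal.span_singleton_pow, Ideal.mem_span_singleton]
    have h2 : k ≤ p.ord a := ((h1 k).mpr hk.symm.dvd).trans (by simpa using h p)
    rw [p.le_ord_iff, hϖ.maximalIdeal_eq, Ideal.span_singleton_pow,
      Ideal.mem_span_singleton] at h2
    exact hk.dvd.trans h2
  obtain ⟨w, hw⟩ := hloc
  obtain ⟨⟨v, s⟩, hv⟩ := IsLocalization.surj p.asIdeal.primeCompl w
  apply s.2
  refine haP ((hmem _ _).mpr ⟨v, ?_⟩)
  apply IsLocalization.injective p.LocalRing p.asIdeal.primeCompl_le_nonZeroDivisors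
  rw [map_mul, map_mul, hw, mul_assoc, hv]

theorem dvd_of_mem_divisorialIdeal {x : A} {b : A⁰} (hx : x ∈ divisorialIdeal (divisorOf b)) :
    (b : A) ∣ x := by
  rcases eq_or_ne x 0 with rfl | hx0
  · exact dvd_zero _
  · exact dvd_iff_divisorOf_le.mpr ((mem_divisorialIdeal_iff hx0).mp hx)

theorem mem_divisorialIdeal_of_mul_mem {E : WeilDivisor A} {x : A} {b : A⁰}
    (h : x * b ∈ divisorialIdeal (E + divisorOf b)) : x ∈ divisorialIdeal E := by
  rcases eq_or_ne x 0 with rfl | hx0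
  · exact zero_mem _
  have h' : ((⟨x, mem_nonZeroDivisors_of_ne_zero hx0⟩ * b : A⁰) : A) ∈
    divisorialIdeal (E + divisorOf b) := h
  rw [coe_mem_divisorialIdeal, divisorOf_mul] at h'
  exact (mem_divisorialIdeal_iff hx0).mpr (le_of_add_le_add_right h')

end Ideals

/-! ### Flat base change of divisorial ideals -/

section BaseChange

/-- Colon ideals `(a) : J` with `J` finitely generated commute with flat base change: the
conditions `x y ∈ (a)`, for `y` among generators of `J`, form a finite linear system over `A`,
whose solutions over a flat algebra are combinations of solutions over `A`. -/
theorem mem_map_colon_of_flat {A B : Type*} [CommRing A] [CommRing B] [Algebra A B]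
    [Module.Flat A B] {I J : Ideal A} (hJ : J.FG) (a : A) (hI : ∀ x, (∀ y ∈ J, a ∣ x * y) → x ∈ I)
    {x : B} (hx : ∀ y ∈ J, algebraMap A B a ∣ x * algebraMap A B y) :
    x ∈ I.map (algebraMap A B) := by
  classical
  obtain ⟨n, y, rfl⟩ := Submodule.fg_iff_exists_fin_generating_family.mp hJ
  have hy : ∀ i, y i ∈ Submodule.span A (Set.range y) :=
    fun i => Submodule.subset_span ⟨i, rfl⟩
  choose z hz using fun i => hx (y i) (hy i)
  let f : (Fin n → A) →ₗ[A] A × (Fin n → A) :=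
    (Fintype.linearCombination A y).prod (-(a • LinearMap.id))
  let g : A × (Fin n → A) →ₗ[A] B :=
    (LinearMap.toSpanSingleton A B x).coprod (Fintype.linearCombination A z)
  have hf : ∀ i, f (Pi.single i 1) = y i • ((1 : A), (0 : Fin n → A))
      - a • ((0 : A), (Pi.single i 1 : Fin n → A)) := fun i => by
    simp [f]
  have hgf : g ∘ₗ f = 0 := by
    refine LinearMap.pi_ext' fun i => LinearMap.ext_ring ?_
    simp only [LinearMap.coe_comp, Function.comp_apply, LinearMap.coe_single, hf, map_sub,
      map_smul]
    simp only [g, LinearMap.coprod_apply, LinearMap.toSpanSingleton_apply, map_zero, map_one,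
      add_zero, zero_add, Fintype.linearCombination_apply_single, Algebra.smul_def,
      LinearMap.zero_apply]
    linear_combination hz i
  obtain ⟨k, u, v, hg, huf⟩ := Module.Flat.exists_factorization_of_comp_eq_zero_of_free hgf
  have hsol : ∀ j, u (1, 0) j ∈ I := fun j => by
    refine hI _ fun w hw => ?_
    induction hw using Submodule.span_induction with
    | mem w hw =>
      obtain ⟨i, rfl⟩ := hw
      refine ⟨u (0, Pi.single i 1) j, ?_⟩
      have h2 := congrArg (fun φ => φ (Pi.single i 1) j) huf
      simp only [LinearMap.coe_comp, Function.comp_apply, hf, map_sub, map_smul,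
        LinearMap.zero_apply, Finsupp.coe_sub, Finsupp.coe_smul, Finsupp.coe_zero, Pi.sub_apply,
        Pi.smul_apply, smul_eq_mul, Pi.zero_apply] at h2
      linear_combination h2
    | zero => simp
    | add w w' _ _ h h' => rw [mul_add]; exact dvd_add h h'
    | smul c w _ h => rw [smul_eq_mul, mul_left_comm]; exact dvd_mul_of_dvd_right h c
  have hx' : x = v (u (1, 0)) := by
    have := congrArg (fun φ => φ ((1 : A), (0 : Fin n → A))) hg
    simpa [g] using this
  rw [hx', ← Finsupp.univ_sum_single (u (1, 0)), map_sum]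
  refine Ideal.sum_mem _ fun j _ => ?_
  have : Finsupp.single j (u (1, 0) j) = u (1, 0) j • Finsupp.single j 1 := by simp
  rw [this, map_smul, Algebra.smul_def]
  exact Ideal.mul_mem_right _ _ (Ideal.mem_map_of_mem _ (hsol j))

variable {A B : Type*} [CommRing A] [CommRing B] [Algebra A B] [IsDomain A] [IsDomain B]
  [Module.Flat A B] [IsNoetherianRing B]

theorem pullbackDiv_mono : Monotone (pullbackDiv A B) := by
  intro D E h q
  simp only [pullbackDiv_apply, pullbackCoeff]
  split_ifs with hq
  · exact mul_le_mul_of_nonneg_left (h _) (Int.natCast_nonneg _)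
  · exact le_rfl

theorem pullbackDiv_nonneg {E : WeilDivisor A} (hE : 0 ≤ E) : 0 ≤ pullbackDiv A B E := by
  simpa using pullbackDiv_mono (B := B) hE

variable [IsNoetherianRing A] [IsIntegrallyClosed A]

theorem algebraMap_mem_divisorialIdeal [IsIntegrallyClosed B] {E : WeilDivisor A} {x : A}
    (hx : x ∈ divisorialIdeal E) : algebraMap A B x ∈ divisorialIdeal (pullbackDiv A B E) := by
  rcases eq_or_ne x 0 with rfl | hx0
  · simp
  rw [mem_divisorialIdeal_iff hx0] at hx
  have h := pullbackDiv_mono (B := B) hx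
  rw [pullbackDiv_divisorOf] at h
  exact coe_mem_divisorialIdeal.mpr h

/-- Divisorial ideals commute with flat base change. If `div a ≥ E`, then
the divisorial ideal of `E` is the colon ideal of `(a)` by the divisorial ideal of `div a - E`. -/
theorem divisorialIdeal_pullbackDiv [IsIntegrallyClosed B] (E : WeilDivisor A) :
    divisorialIdeal (pullbackDiv A B E) = (divisorialIdeal E).map (algebraMap A B) := by
  apply le_antisymm
  · intro x hx
    obtain ⟨a, ha⟩ := exists_ne_zero_mem_divisorialIdeal E
    refine mem_map_colon_of_flat (J := divisorialIdeal (divisorOf a - E))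
      (IsNoetherian.noetherian _) a ?_ ?_
    · intro y hy
      rcases eq_or_ne y 0 with rfl | hy0
      · exact zero_mem _
      rw [mem_divisorialIdeal_iff hy0]
      intro p
      -- Test `y` against a multiplier whose order at `p` is the least possible.
      obtain ⟨t, ht, htp⟩ := exists_ord_eq (sub_nonneg.mpr ha) p
      have h := hy t (coe_mem_divisorialIdeal.mpr ht)
      have h' := dvd_iff_divisorOf_le (a := ⟨y, mem_nonZeroDivisors_of_ne_zero hy0⟩ * t).mp h p
      rw [divisorOf_mul, Finsupp.add_apply, htp, Finsupp.sub_apply] at h'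
      linarith
    · intro y hy
      have h := mul_mem_divisorialIdeal hx (algebraMap_mem_divisorialIdeal (B := B) hy)
      rw [map_sub, add_sub_cancel, pullbackDiv_divisorOf] at h
      exact dvd_of_mem_divisorialIdeal h
  · rw [Ideal.map_le_iff_le_comap]
    exact fun x hx => algebraMap_mem_divisorialIdeal hx

end BaseChange

/-! ### Sections of the structure sheaf of a domain -/

section Sections

open AlgebraicGeometry CategoryTheory

variable {A : CommRingCat}

/-- The functions on `Spec A`, viewed as sections of the structure sheaf over `U`. -/
noncomputable abbrev toSections (U : (Spec A).Opens) : A →+* Γ(Spec A, U) :=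
  algebraMap A Γ(Spec A, U)

theorem map_toSections {U V : (Spec A).Opens} (i : V ⟶ U) (a : A) :
    (Spec A).presheaf.map i.op (toSections U a) = toSections V a := rfl

theorem basicOpen_toSections (U : (Spec A).Opens) (a : A) :
    (Spec A).basicOpen (toSections U a) = U ⊓ PrimeSpectrum.basicOpen a := by
  have h := (Spec A).basicOpen_res
    (toSections ⊤ a) (homOfLE (le_top : U ≤ ⊤)).op
  rw [map_toSections] at h
  rw [h]
  congr 1
  exact basicOpen_eq_of_affine a

theorem isLocalization_away_Spec {U : (Spec A).Opens} {a : A} (h : U = PrimeSpectrum.basicOpen a) :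
    IsLocalization.Away a Γ(Spec A, U) := by
  subst h
  exact StructureSheaf.IsLocalization.to_basicOpen A a

theorem isUnit_toSections {U : (Spec A).Opens} {a : A}
    (h : U ≤ PrimeSpectrum.basicOpen a) : IsUnit (toSections U a) := by
  let V : (Spec A).Opens := PrimeSpectrum.basicOpen a
  have : IsLocalization.Away a Γ(Spec A, V) := isLocalization_away_Spec rfl
  have : IsUnit (toSections V a) := IsLocalization.Away.algebraMap_isUnit a
  have := this.map ((Spec A).presheaf.map (homOfLE h : U ⟶ V).op).hom
  exact this

variable [IsDomain A]

theorem nonempty_of_bot_mem {U : (Spec A).Opens} (h : (⊥ : PrimeSpectrum A) ∈ U) : Nonempty U :=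
  ⟨⟨_, h⟩⟩

theorem toSections_injective {U : (Spec A).Opens} [Nonempty U] :
    Function.Injective (toSections U) := by
  rw [injective_iff_map_eq_zero]
  intro a ha
  have h := basicOpen_toSections U a
  rw [ha, Scheme.basicOpen_zero] at h
  by_contra ha0
  have hbot : (⊥ : PrimeSpectrum A) ∈ U := by
    obtain ⟨⟨P, hP⟩⟩ := ‹Nonempty U›
    have : (⊥ : PrimeSpectrum A) ⤳ P :=
      (PrimeSpectrum.le_iff_specializes _ _).mp bot_le
    exact this.mem_open U.isOpen hP
  have : (⊥ : PrimeSpectrum A) ∈ U ⊓ PrimeSpectrum.basicOpen a := ⟨hbot, ha0⟩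
  rw [← h] at this
  exact this

/-- Over the basic open subset of `f` a section is a fraction with denominator a power of `f`. The
equality holds on all of `U`, as restriction of sections is injective on an integral scheme. -/
theorem exists_pow_mul_eq_toSections {U : (Spec A).Opens} {f : A} (hf : f ≠ 0)
    (hU : PrimeSpectrum.basicOpen f ≤ U) (t : Γ(Spec A, U)) :
    ∃ (k : ℕ) (a : A), toSections U (f ^ k) * t = toSections U a := by
  let V : (Spec A).Opens := PrimeSpectrum.basicOpen f
  have : Nonempty V := nonempty_of_bot_mem hf
  have : IsLocalization.Away f Γ(Spec A, V) := isLocalization_away_Spec rfl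
  obtain ⟨k, a, h⟩ := IsLocalization.Away.surj f
    ((Spec A).presheaf.map (homOfLE hU : V ⟶ U).op t)
  refine ⟨k, a, map_injective_of_isIntegral _ (homOfLE hU : V ⟶ U) ?_⟩
  rw [map_mul, map_toSections, map_toSections, mul_comm, map_pow]
  exact h

/-- A fraction `x / s` is a section of the structure sheaf over `U` as soon as its denominators,
the `b` with `s ∣ b * x`, have no common zero on `U`. -/
theorem exists_section_mul_eq {U : (Spec A).Opens} (hU : (⊥ : PrimeSpectrum A) ∈ U) {x s : A}
    (hs : s ≠ 0) (h : ∀ P : PrimeSpectrum A, P ∈ U → ∃ b ∉ P.asIdeal, s ∣ b * x) :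
    ∃ t : Γ(Spec A, U), toSections U s * t = toSections U x := by
  let ι := {b : A // b ≠ 0 ∧ s ∣ b * x}
  let V : ι → (Spec A).Opens := fun b => U ⊓ PrimeSpectrum.basicOpen b.1
  have hV : ∀ b, (⊥ : PrimeSpectrum A) ∈ V b := fun b => ⟨hU, b.2.1⟩
  have hcancel : ∀ W : (Spec A).Opens, (⊥ : PrimeSpectrum A) ∈ W → ∀ t t' : Γ(Spec A, W),
      toSections _ s * t = toSections _ s * t' → t = t' := fun W hW t t' htt' => by
    have := nonempty_of_bot_mem hW
    have hs' : toSections W s ≠ 0 := fun h0 =>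
      hs (toSections_injective (h0.trans (map_zero _).symm))
    exact mul_left_cancel₀ hs' htt'
  have hsec : ∀ b : ι, ∃ t : Γ(Spec A, V b), toSections _ s * t = toSections _ x := fun b => by
    obtain ⟨c, hc⟩ := b.2.2
    obtain ⟨u, hu⟩ := isUnit_toSections (U := V b) (a := b.1) inf_le_right
    refine ⟨toSections (V b) c * ↑u⁻¹, ?_⟩
    rw [← mul_assoc, ← map_mul, ← hc, map_mul, mul_right_comm, ← hu, Units.mul_inv, one_mul]
  choose σ hσ using hsec
  have hcover : U ≤ iSup V := fun P hP => by
    obtain ⟨b, hbP, hb⟩ := h P hP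
    have hb0 : b ≠ 0 := fun h0 => hbP (h0 ▸ zero_mem _)
    exact TopologicalSpace.Opens.mem_iSup.mpr ⟨⟨b, hb0, hb⟩, hP, hbP⟩
  have hcompat : TopCat.Presheaf.IsCompatible (Spec A).sheaf.1 V σ := fun b b' => by
    refine hcancel (V b ⊓ V b') ⟨hV b, hV b'⟩ _ _ ?_
    have h1 := congrArg ((Spec A).presheaf.map (TopologicalSpace.Opens.infLELeft (V b) (V b')).op)
      (hσ b)
    have h2 := congrArg ((Spec A).presheaf.map (TopologicalSpace.Opens.infLERight (V b) (V b')).op)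
      (hσ b')
    rw [map_mul, map_toSections, map_toSections] at h1 h2
    exact h1.trans h2.symm
  obtain ⟨t, ht, -⟩ := (Spec A).sheaf.existsUnique_gluing' V U
    (fun b => homOfLE inf_le_left) hcover σ hcompat
  refine ⟨t, TopCat.Sheaf.eq_of_locally_eq' (Spec A).sheaf V U (fun b => homOfLE inf_le_left)
    hcover _ _ fun b => ?_⟩
  have := hσ b
  rw [← ht b] at this
  exact (map_mul _ _ _).trans this

end Sections

/-! ### Affineness of the complement of a divisor -/

section Affine

open AlgebraicGeometry CategoryTheory

theorem mem_complement_iff {A : Type*} [CommRing A] {E : WeilDivisor A} {P : PrimeSpectrum A} :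
    P ∈ complement E ↔ ∀ p : PrimeDivisor A, E p ≠ 0 → ¬ p.asIdeal ≤ P.asIdeal := by
  have : P ∈ complement E ↔ P ∉ supportSet E := Iff.rfl
  rw [this]
  simp [supportSet, PrimeSpectrum.mem_zeroLocus]

variable {A : Type*} [CommRing A] [IsDomain A]

theorem bot_mem_complement (E : WeilDivisor A) : (⊥ : PrimeSpectrum A) ∈ complement E :=
  mem_complement_iff.mpr fun p _ hp =>
    Ideal.ne_bot_of_height_eq_one p.height_eq_one (le_bot_iff.mp hp)

variable [IsNoetherianRing A] [IsIntegrallyClosed A]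

theorem basicOpen_le_complement {E : WeilDivisor A} (hE : 0 ≤ E) {x : A}
    (hx : x ∈ divisorialIdeal E) : PrimeSpectrum.basicOpen x ≤ complement E := fun P hP => by
  refine mem_complement_iff.mpr fun p hp hle => hP (hle ?_)
  rcases eq_or_ne x 0 with rfl | hx0
  · exact zero_mem _
  rw [mem_divisorialIdeal_iff hx0] at hx
  have h1 := hx p
  have h2 := hE p
  rw [divisorOf_apply] at h1
  rw [Finsupp.zero_apply] at h2
  exact (p.ord_pos_iff ⟨x, mem_nonZeroDivisors_of_ne_zero hx0⟩).mp (by omega)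

/-- If `E + F = div s`, a section over the complement of `E` becomes, after multiplication by a
high power of `s`, a function with divisor at least a multiple of `F`. -/
theorem exists_pow_mul_mem_divisorialIdeal {E F : WeilDivisor A} (hE : 0 ≤ E) (hF : 0 ≤ F) {s : A⁰}
    (hEF : E + F = divisorOf s) (t : Γ(Spec (CommRingCat.of A), complement E)) :
    ∃ n : ℕ, ∃ x ∈ divisorialIdeal (n • F),
      toSections (complement E) ((s : A) ^ n) * t = toSections (complement E) x := by
  have hne : Nonempty (complement E) := ⟨⟨_, bot_mem_complement E⟩⟩
  have hinj := toSections_injective (A := CommRingCat.of A) (U := complement E)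
  have hs0 : (s : A) ≠ 0 := nonZeroDivisors.coe_ne_zero s
  have hsE : (s : A) ∈ divisorialIdeal E :=
    coe_mem_divisorialIdeal.mpr (hEF ▸ le_add_of_nonneg_right hF)
  obtain ⟨k, x, hx⟩ := exists_pow_mul_eq_toSections (A := CommRingCat.of A) hs0
    (basicOpen_le_complement hE hsE) t
  -- Extra factors `s` give the required order along the support of `E`, where `F < div s`.
  let N := k * ∑ p ∈ E.support, p.ord s
  refine ⟨k + N, x * s ^ N, ?_, ?_⟩
  · rcases eq_or_ne x 0 with rfl | hx0
    · simp
    have hmem : ((⟨x, mem_nonZeroDivisors_of_ne_zero hx0⟩ * s ^ N : A⁰) : A) ∈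
        divisorialIdeal ((k + N) • F) := by
      rw [coe_mem_divisorialIdeal, divisorOf_mul, divisorOf_pow]
      intro p
      have hp := DFunLike.congr_fun hEF p
      have hE0 : 0 ≤ E p := hE p
      simp only [Finsupp.add_apply, Finsupp.smul_apply, divisorOf_apply, nsmul_eq_mul,
        Nat.cast_add] at hp ⊢
      have hFp : F p = p.ord s - E p := by linarith
      rw [hFp]
      rcases hE0.eq_or_lt with h0 | hpos
      · -- Outside the support of `E` the section `x / s ^ k` is regular.
        rw [← h0]
        have hle : k * p.ord s ≤ p.ord x := by
          obtain ⟨f, hfE, hfp⟩ := exists_mem_divisorialIdeal_notMem (E := E) p.asIdeal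
            fun q hq hle => by
              rw [PrimeDivisor.eq_of_le hle, ← h0] at hq
              exact lt_irrefl _ hq
          have hf0 : f ≠ 0 := fun h => hfp (h ▸ zero_mem _)
          obtain ⟨j, a, ha⟩ := exists_pow_mul_eq_toSections (A := CommRingCat.of A) hf0
            (basicOpen_le_complement hE hfE) t
          have hax : f ^ j * x = s ^ k * a := by
            apply hinj
            rw [map_mul, map_mul, ← hx, ← ha]
            ring
          have hdvd : ((s ^ k : A⁰) : A) ∣ ((⟨f, mem_nonZeroDivisors_of_ne_zero hf0⟩ ^ j *
              ⟨x, mem_nonZeroDivisors_of_ne_zero hx0⟩ : A⁰) : A) := ⟨a, hax⟩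
          have := dvd_iff_divisorOf_le.mp hdvd p
          rw [divisorOf_mul, divisorOf_pow, divisorOf_pow] at this
          simp only [Finsupp.add_apply, Finsupp.smul_apply, divisorOf_apply, nsmul_eq_mul,
            p.ord_eq_zero hfp, Nat.cast_zero, mul_zero, zero_add] at this
          exact_mod_cast this
        have : (k : ℤ) * p.ord s ≤ p.ord x := by exact_mod_cast hle
        linarith
      · have hN : k * p.ord s ≤ N :=
          Nat.mul_le_mul_left _ (Finset.single_le_sum (f := fun p : PrimeDivisor A => p.ord s)
            (fun _ _ => Nat.zero_le _) (Finsupp.mem_support_iff.mpr hpos.ne'))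
        have hN' : (k : ℤ) * p.ord s ≤ N := by exact_mod_cast hN
        have : (N : ℤ) ≤ (k + N) * E p := by nlinarith
        have : (0 : ℤ) ≤ p.ord x := Int.natCast_nonneg _
        linarith
    exact hmem
  · rw [map_mul, pow_add, map_mul, ← hx]
    ring

/-- Let `E + F = div s` with `E` and `F` effective. On the complement `U` of `E` the functions
`x / s ^ n`, with `div x ≥ n F`, are regular, and every section over `U` is of this form. Hence
the right-hand side says that the functions vanishing along `E` generate the unit ideal of
`Γ(U, 𝒪)`. These functions have no common zero on `U`, and their nonvanishing loci are affine and
contained in `U`. -/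
theorem isAffineOpen_complement_iff {E F : WeilDivisor A} (hE : 0 ≤ E) (hF : 0 ≤ F) {s : A⁰}
    (hEF : E + F = divisorOf s) :
    IsAffineOpen (complement E) ↔
      ∃ n : ℕ, (s : A) ^ n ∈ divisorialIdeal (n • F) * divisorialIdeal E := by
  have hne : Nonempty (complement E) := ⟨⟨_, bot_mem_complement E⟩⟩
  have hinj := toSections_injective (A := CommRingCat.of A) (U := complement E)
  have hs0 : (s : A) ≠ 0 := nonZeroDivisors.coe_ne_zero s
  have hsF : (s : A) ∈ divisorialIdeal F :=
    coe_mem_divisorialIdeal.mpr (hEF ▸ le_add_of_nonneg_left hE)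
  let R : Set Γ(Spec (CommRingCat.of A), complement E) :=
    toSections (complement E) '' (divisorialIdeal E : Set A)
  constructor
  · intro hU
    have hspan : Ideal.span R = ⊤ := by
      rw [← hU.self_le_iSup_basicOpen_iff]
      rintro (P : PrimeSpectrum A) hP
      obtain ⟨b, hb, hbP⟩ := exists_mem_divisorialIdeal_notMem (E := E)
        P.asIdeal fun p hp => mem_complement_iff.mp hP p hp.ne'
      refine TopologicalSpace.Opens.mem_iSup.mpr ⟨⟨_, b, hb, rfl⟩, ?_⟩
      rw [basicOpen_toSections (A := CommRingCat.of A)]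
      exact ⟨hP, hbP⟩
    have key : ∀ w ∈ Ideal.span R, ∃ n : ℕ, ∃ z ∈ divisorialIdeal (n • F) * divisorialIdeal E,
        toSections (complement E) ((s : A) ^ n) * w = toSections (complement E) z := by
      intro w hw
      induction hw using Submodule.span_induction with
      | mem w hw =>
        obtain ⟨r, hr, rfl⟩ := hw
        refine ⟨0, r, ?_, by simp⟩
        rw [zero_smul, divisorialIdeal_zero, Ideal.top_mul]
        exact hr
      | zero => exact ⟨0, 0, zero_mem _, by simp⟩
      | add w w' _ _ h h' =>
        obtain ⟨n, z, hz, hw⟩ := h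
        obtain ⟨n', z', hz', hw'⟩ := h'
        refine ⟨n + n', s ^ n' * z + s ^ n * z', add_mem ?_ ?_, ?_⟩
        · rw [add_comm n]
          exact mul_mem_divisorialIdeal_mul (pow_mem_divisorialIdeal hsF n') hz
        · exact mul_mem_divisorialIdeal_mul (pow_mem_divisorialIdeal hsF n) hz'
        · rw [map_add, map_mul, map_mul, ← hw, ← hw', pow_add, map_mul]
          ring
      | smul t w _ h =>
        obtain ⟨n, z, hz, hw⟩ := h
        obtain ⟨m, x, hx, ht⟩ := exists_pow_mul_mem_divisorialIdeal hE hF hEF t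
        refine ⟨m + n, x * z, mul_mem_divisorialIdeal_mul hx hz, ?_⟩
        · rw [map_mul, ← ht, ← hw, pow_add, map_mul, smul_eq_mul]
          ring
    obtain ⟨n, z, hz, h⟩ := key 1 (hspan ▸ Submodule.mem_top)
    refine ⟨n, ?_⟩
    rw [mul_one] at h
    rwa [hinj h]
  · rintro ⟨n, hn⟩
    have hsn : (s : A) ^ n ≠ 0 := pow_ne_zero _ hs0
    have key : ∀ z ∈ divisorialIdeal (n • F) * divisorialIdeal E, ∃ w ∈ Ideal.span R,
        toSections (complement E) ((s : A) ^ n) * w = toSections (complement E) z := by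
      intro z hz
      induction hz using Submodule.mul_induction_on' with
      | mem_mul_mem x hx r hr =>
        obtain ⟨t, ht⟩ := exists_section_mul_eq (A := CommRingCat.of A) (U := complement E)
          (bot_mem_complement E) (x := x) hsn fun P hP => by
            obtain ⟨b, hb, hbP⟩ := exists_mem_divisorialIdeal_notMem (E := n • E)
              P.asIdeal fun p hp => mem_complement_iff.mp hP p fun h0 => by
                simp [h0] at hp
            refine ⟨b, hbP, dvd_of_mem_divisorialIdeal (b := s ^ n) ?_⟩
            rw [divisorOf_pow, ← hEF, smul_add]
            exact mul_mem_divisorialIdeal hb hx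
        refine ⟨t * toSections (complement E) r,
          Ideal.mul_mem_left _ _ (Ideal.subset_span ⟨r, hr, rfl⟩), ?_⟩
        rw [← mul_assoc, ht, ← map_mul]
      | add x _ y _ h h' =>
        obtain ⟨w, hw, h⟩ := h
        obtain ⟨w', hw', h'⟩ := h'
        exact ⟨w + w', add_mem hw hw', by rw [mul_add, h, h', map_add]⟩
    obtain ⟨w, hw, h⟩ := key _ hn
    have hsn' : toSections (complement E) ((s : A) ^ n) ≠ 0 := fun h0 =>
      hsn (hinj (h0.trans (map_zero _).symm))
    rw [mul_eq_left₀ hsn'] at h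
    refine isAffineOpen_of_isAffineOpen_basicOpen _ R
      ((Ideal.eq_top_iff_one _).mpr (h ▸ hw)) ?_
    rintro _ ⟨r, hr, rfl⟩
    have hbasic := (basicOpen_toSections (A := CommRingCat.of A) (complement E) r).trans
      (inf_eq_right.mpr (basicOpen_le_complement hE hr))
    rw [hbasic]
    exact IsAffineOpen.Spec_basicOpen (R := CommRingCat.of A) r

end Affine

/-! ### Coaffine divisors and divisorial ideals -/

section Coaffine

variable {A : Type*} [CommRing A] [IsDomain A] [IsNoetherianRing A]

theorem LinearlyEquivalent.symm {D E : WeilDivisor A} (h : LinearlyEquivalent D E) :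
    LinearlyEquivalent E D := by
  simpa [LinearlyEquivalent] using neg_mem h

theorem LinearlyEquivalent.trans {D E F : WeilDivisor A} (h : LinearlyEquivalent D E)
    (h' : LinearlyEquivalent E F) : LinearlyEquivalent D F := by
  simpa [LinearlyEquivalent] using add_mem h h'

theorem LinearlyEquivalent.zsmul {D E : WeilDivisor A} (h : LinearlyEquivalent D E) (n : ℤ) :
    LinearlyEquivalent (n • D) (n • E) := by
  simpa [LinearlyEquivalent, smul_sub] using AddSubgroup.zsmul_mem _ h n

theorem LinearlyEquivalent.add_left {D E : WeilDivisor A} (h : LinearlyEquivalent D E)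
    (F : WeilDivisor A) : LinearlyEquivalent (F + D) (F + E) := by
  simpa [LinearlyEquivalent] using h

theorem linearlyEquivalent_neg_of_add_eq {E F : WeilDivisor A} {s : A⁰}
    (h : E + F = divisorOf s) : LinearlyEquivalent E (-F) :=
  ⟨s, 1, by rw [divisorOf_one, sub_neg_eq_add, h, sub_zero]⟩

theorem IsCoaffine.congr {D E : WeilDivisor A} (h : LinearlyEquivalent D E)
    (hD : IsCoaffine D) : IsCoaffine E :=
  fun E' hE' hE'E => hD E' hE' (hE'E.trans h.symm)

variable [IsIntegrallyClosed A]

/-- If `E + F = div s` and `F + G = div d` with `E` effective, multiplication by `s / d` maps the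
divisorial ideal of `G` into that of `E`, and likewise for their products with an ideal `J`. -/
theorem exists_mul_eq_mul_of_add_eq {E F G : WeilDivisor A} (hE : 0 ≤ E) {s d : A⁰}
    (hs : E + F = divisorOf s) (hd : F + G = divisorOf d) {J : Ideal A} {z : A}
    (hz : z ∈ J * divisorialIdeal G) : ∃ w ∈ J * divisorialIdeal E, (s : A) * z = d * w := by
  induction hz using Submodule.mul_induction_on' with
  | mem_mul_mem x hx y hy =>
    have h := mul_mem_divisorialIdeal (coe_mem_divisorialIdeal.mpr hs.le) hy
    rw [add_assoc, hd] at h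
    obtain ⟨r, hr⟩ := dvd_of_mem_divisorialIdeal
      (divisorialIdeal_anti (le_add_of_nonneg_left hE) h)
    rw [hr, mul_comm] at h
    exact ⟨x * r, Ideal.mul_mem_mul hx (mem_divisorialIdeal_of_mul_mem h), by
      linear_combination x * hr⟩
  | add x _ y _ h h' =>
    obtain ⟨w, hw, h⟩ := h
    obtain ⟨w', hw', h'⟩ := h'
    exact ⟨w + w', add_mem hw hw', by rw [mul_add, h, h', mul_add]⟩

/-- Coaffineness as a condition on divisorial ideals: `-F` is coaffine if and only if, for every
section `s` of `𝒪(-F)`, some power of `s` lies in the ideal generated by the sections of `𝒪(F)`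
in the graded ring `⨁ 𝒪(nF)`. Here `𝒪(F)` is written as `1 / d` times the divisorial ideal of
`G = div d - F`. -/
theorem isCoaffine_neg_iff {F G : WeilDivisor A} (hF : 0 ≤ F) (hG : 0 ≤ G) {d : A⁰}
    (hd : F + G = divisorOf d) :
    IsCoaffine (-F) ↔ ∀ s ∈ divisorialIdeal F, ∃ m : ℕ,
      (d : A) * s ^ m ∈ divisorialIdeal ((m + 1) • F) * divisorialIdeal G := by
  have hd0 : (d : A) ≠ 0 := nonZeroDivisors.coe_ne_zero d
  constructor
  · intro h s hs
    rcases eq_or_ne s 0 with rfl | hs0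
    · exact ⟨1, by simp⟩
    let s' : A⁰ := ⟨s, mem_nonZeroDivisors_of_ne_zero hs0⟩
    have hE : 0 ≤ divisorOf s' - F := sub_nonneg.mpr ((mem_divisorialIdeal_iff hs0).mp hs)
    have hEF : divisorOf s' - F + F = divisorOf s' := sub_add_cancel _ _
    obtain ⟨n, hn⟩ := (isAffineOpen_complement_iff hE hF hEF).mp
      (h _ hE (linearlyEquivalent_neg_of_add_eq hEF))
    rw [add_comm] at hd hEF
    obtain ⟨w, hw, hsw⟩ := exists_mul_eq_mul_of_add_eq hG hd hEF hn
    refine ⟨n, ?_⟩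
    have hdw : d * s ^ n = s * w := hsw
    rw [hdw, add_comm]
    exact mul_mem_divisorialIdeal_mul (by rwa [one_smul]) hw
  · rintro h E hE ⟨a, b, hab⟩
    have hba : (b : A) ∣ a := by
      rw [dvd_iff_divisorOf_le, ← sub_nonneg, ← hab, sub_neg_eq_add]
      exact add_nonneg hE hF
    obtain ⟨s, hs⟩ := hba
    have hs0 : s ≠ 0 := by
      rintro rfl
      exact nonZeroDivisors.coe_ne_zero a (by rw [hs, mul_zero])
    let s' : A⁰ := ⟨s, mem_nonZeroDivisors_of_ne_zero hs0⟩
    have hEF : E + F = divisorOf s' := by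
      have : a = b * s' := Subtype.ext hs
      rw [this, divisorOf_mul, sub_neg_eq_add] at hab
      rw [hab, add_sub_cancel_left]
    obtain ⟨m, hm⟩ := h s
      ((mem_divisorialIdeal_iff hs0).mpr (hEF ▸ le_add_of_nonneg_left hE))
    obtain ⟨w, hw, hsw⟩ := exists_mul_eq_mul_of_add_eq hE hEF hd hm
    rw [isAffineOpen_complement_iff hE hF hEF]
    refine ⟨m + 1, ?_⟩
    have : s ^ (m + 1) = w := mul_left_cancel₀ hd0 (by
      rw [← hsw]
      change d * s ^ (m + 1) = s * (d * s ^ m)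
      ring)
    rwa [this]

theorem isCoaffine_of_mem_principalDivisors {D : WeilDivisor A}
    (hD : D ∈ principalDivisors A) : IsCoaffine D := by
  have h : LinearlyEquivalent (-0) D := by
    simpa [LinearlyEquivalent] using neg_mem hD
  refine IsCoaffine.congr h ?_
  rw [isCoaffine_neg_iff le_rfl le_rfl (d := 1) (by rw [divisorOf_one, add_zero])]
  exact fun s _ => ⟨0, by simp [divisorialIdeal_zero]⟩

theorem isStronglyCoaffine_iff {D : WeilDivisor A} :
    IsStronglyCoaffine D ↔ ∀ n : ℤ, IsCoaffine (n • D) :=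
  forall_congr' fun _ => or_iff_left_of_imp isCoaffine_of_mem_principalDivisors

theorem IsStronglyCoaffine.congr {D E : WeilDivisor A} (h : LinearlyEquivalent D E)
    (hD : IsStronglyCoaffine D) : IsStronglyCoaffine E := by
  rw [isStronglyCoaffine_iff] at hD ⊢
  exact fun n => (hD n).congr (h.zsmul n)

theorem principalDivisors_le_affineTrivialDivisors :
    principalDivisors A ≤ affineTrivialDivisors A := fun D hD E hE => by
  refine hE.congr ?_
  simpa [LinearlyEquivalent] using neg_mem hD

end Coaffine

/-! ### Coaffine divisors under faithfully flat pull-back -/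

section Pullback

variable {A B : Type*} [CommRing A] [IsDomain A] [IsNoetherianRing A] [IsIntegrallyClosed A]
  [CommRing B] [IsDomain B] [IsNoetherianRing B] [Algebra A B]

theorem LinearlyEquivalent.pullbackDiv [Module.Flat A B] {D E : WeilDivisor A}
    (h : LinearlyEquivalent D E) :
    LinearlyEquivalent (pullbackDiv A B D) (pullbackDiv A B E) := by
  rw [LinearlyEquivalent, ← map_sub]
  exact principalDivisors_le_comap A B h

theorem exists_linearlyEquivalent_pullbackDiv [Module.Flat A B]
    (hCl : Function.Surjective (pullbackCl A B))
    (D' : WeilDivisor B) : ∃ D : WeilDivisor A, LinearlyEquivalent (pullbackDiv A B D) D' := by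
  obtain ⟨x, hx⟩ := hCl (QuotientAddGroup.mk D')
  induction x using QuotientAddGroup.induction_on with | H D => ?_
  exact ⟨D, QuotientAddGroup.eq_iff_sub_mem.mp hx⟩

variable [IsIntegrallyClosed B] [Module.FaithfullyFlat A B]

/-- Coaffineness is invariant under faithfully flat pull-back. The sections of the pull-back of
`𝒪(-F)` are linear combinations of sections of `𝒪(-F)`, and the condition of
`isCoaffine_neg_iff` is that these lie in the radical of an ideal compatible with base change. -/
theorem isCoaffine_pullbackDiv_iff {D : WeilDivisor A} :
    IsCoaffine (pullbackDiv A B D) ↔ IsCoaffine D := by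
  obtain ⟨c, hc⟩ := exists_ne_zero_mem_divisorialIdeal D
  obtain ⟨F, rfl⟩ : ∃ F, D = divisorOf c - F := ⟨divisorOf c - D, by abel⟩
  have hF : 0 ≤ F := by simpa using hc
  obtain ⟨d, hFd⟩ := exists_ne_zero_mem_divisorialIdeal F
  obtain ⟨G, hd⟩ : ∃ G, F + G = divisorOf d := ⟨divisorOf d - F, by abel⟩
  have hG : 0 ≤ G := by simpa [← hd] using hFd
  have hlin : LinearlyEquivalent (divisorOf c - F) (-F) :=
    linearlyEquivalent_neg_of_add_eq (sub_add_cancel _ _)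
  have hlin' := hlin.pullbackDiv (B := B)
  have hd' := congrArg (pullbackDiv A B) hd
  rw [map_add, pullbackDiv_divisorOf] at hd'
  rw [map_neg] at hlin'
  have e1 : IsCoaffine (divisorOf c - F) ↔ IsCoaffine (-F) := ⟨.congr hlin, .congr hlin.symm⟩
  have e2 : IsCoaffine (pullbackDiv A B (divisorOf c - F)) ↔ IsCoaffine (-pullbackDiv A B F) :=
    ⟨.congr hlin', .congr hlin'.symm⟩
  rw [e1, e2, isCoaffine_neg_iff hF hG hd,
    isCoaffine_neg_iff (pullbackDiv_nonneg hF) (pullbackDiv_nonneg hG) hd']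
  have hprod : ∀ n : ℕ, divisorialIdeal (n • pullbackDiv A B F) *
      divisorialIdeal (pullbackDiv A B G) =
        (divisorialIdeal (n • F) * divisorialIdeal G).map (algebraMap A B) := fun n => by
    rw [← map_nsmul, divisorialIdeal_pullbackDiv, divisorialIdeal_pullbackDiv, Ideal.map_mul]
  constructor
  · intro h s hs
    obtain ⟨m, hm⟩ := h (algebraMap A B s) (algebraMap_mem_divisorialIdeal hs)
    refine ⟨m, ?_⟩
    rw [← Ideal.comap_map_eq_self_of_faithfullyFlat (B := B)
      (divisorialIdeal ((m + 1) • F) * divisorialIdeal G), Ideal.mem_comap, map_mul, map_pow,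
      ← hprod]
    exact hm
  · intro h s hs
    suffices s ∈ divisorialIdeal (pullbackDiv A B F) ∧ ∃ m : ℕ, algebraMap A B d * s ^ m ∈
        divisorialIdeal ((m + 1) • pullbackDiv A B F) * divisorialIdeal (pullbackDiv A B G)
      from this.2
    rw [divisorialIdeal_pullbackDiv] at hs
    induction hs using Submodule.span_induction with
    | mem s hs =>
      obtain ⟨s, hs, rfl⟩ := hs
      obtain ⟨m, hm⟩ := h s hs
      refine ⟨algebraMap_mem_divisorialIdeal hs, m, ?_⟩
      rw [← map_pow, ← map_mul, hprod]
      exact Ideal.mem_map_of_mem _ hm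
    | zero => exact ⟨zero_mem _, 1, by simp⟩
    | add s t _ _ hs ht =>
      obtain ⟨hs, m, hm⟩ := hs
      obtain ⟨ht, k, hk⟩ := ht
      have hmul : ∀ {u v : B} {l i j : ℕ}, u ∈ divisorialIdeal (pullbackDiv A B F) →
          v ∈ divisorialIdeal (pullbackDiv A B F) → algebraMap A B d * u ^ l ∈
            divisorialIdeal ((l + 1) • pullbackDiv A B F) * divisorialIdeal (pullbackDiv A B G) →
          l ≤ i → algebraMap A B d * (u ^ i * v ^ j) ∈
            divisorialIdeal ((i + j + 1) • pullbackDiv A B F) *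
              divisorialIdeal (pullbackDiv A B G) := by
        intro u v l i j hu hv hl hli
        have huv := mul_mem_divisorialIdeal (pow_mem_divisorialIdeal hu (i - l))
          (pow_mem_divisorialIdeal hv j)
        rw [← add_smul] at huv
        have h := mul_mem_divisorialIdeal_mul huv hl
        have e1 : i - l + j + (l + 1) = i + j + 1 := by omega
        have e2 : u ^ i = u ^ (i - l) * u ^ l := by rw [← pow_add, Nat.sub_add_cancel hli]
        rw [e1] at h
        rw [e2]
        convert h using 1
        ring
      refine ⟨add_mem hs ht, m + k, ?_⟩
      -- In each term of the binomial expansion one of the two exponents is large enough.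
      rw [add_pow, Finset.mul_sum]
      refine Ideal.sum_mem _ fun i hi => ?_
      rw [← mul_assoc]
      refine Ideal.mul_mem_right _ _ ?_
      have hi' : i + (m + k - i) = m + k := by have := Finset.mem_range.mp hi; omega
      rcases le_total m i with hmi | him
      · have := hmul (j := m + k - i) hs ht hm hmi
        rwa [hi'] at this
      · have := hmul (i := m + k - i) (j := i) ht hs hk (by omega)
        rwa [add_comm (m + k - i), hi', mul_comm (t ^ _)] at this
    | smul c s _ hs =>
      obtain ⟨hs, m, hm⟩ := hs
      refine ⟨Ideal.mul_mem_left _ _ hs, m, ?_⟩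
      rw [smul_eq_mul, mul_pow, mul_left_comm]
      exact Ideal.mul_mem_left _ _ hm

theorem isStronglyCoaffine_pullbackDiv_iff {D : WeilDivisor A} :
    IsStronglyCoaffine (pullbackDiv A B D) ↔ IsStronglyCoaffine D := by
  simp only [isStronglyCoaffine_iff, ← map_zsmul, isCoaffine_pullbackDiv_iff]

/-- If every divisor class of `B` comes from `A`, affine triviality over `B` can be tested on
pull-backs of divisors. -/
theorem isAffineTrivial_pullbackDiv_iff (hCl : Function.Surjective (pullbackCl A B))
    {D : WeilDivisor A} : IsAffineTrivial (pullbackDiv A B D) ↔ IsAffineTrivial D := by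
  constructor
  · intro h E hE
    rw [← isStronglyCoaffine_pullbackDiv_iff (B := B)] at hE ⊢
    rw [map_add]
    exact h _ hE
  · intro h E' hE'
    obtain ⟨E, hE⟩ := exists_linearlyEquivalent_pullbackDiv hCl E'
    have h' := h E (isStronglyCoaffine_pullbackDiv_iff.mp (hE'.congr hE.symm))
    rw [← isStronglyCoaffine_pullbackDiv_iff (B := B), map_add] at h'
    exact h'.congr (hE.add_left _)

end Pullback

end NormalDomain

theorem mainTheorem1 {A A' : Type*} [CommRing A] [IsDomain A] [IsNoetherianRing A]
    [IsIntegrallyClosed A] [CommRing A'] [IsDomain A'] [IsNoetherianRing A']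
    [IsIntegrallyClosed A'] [Algebra A A'] [Module.FaithfullyFlat A A']
    (hCl : Function.Surjective (NormalDomain.pullbackCl A A')) :
    ∃ e : NormalDomain.ACl A ≃+ NormalDomain.ACl A', ∀ D : NormalDomain.WeilDivisor A,
      e (QuotientAddGroup.mk D) = QuotientAddGroup.mk (NormalDomain.pullbackDiv A A' D) := by
  have hcomap : (NormalDomain.affineTrivialDivisors A').comap (NormalDomain.pullbackDiv A A') =
      NormalDomain.affineTrivialDivisors A :=
    AddSubgroup.ext fun _ => NormalDomain.isAffineTrivial_pullbackDiv_iff hCl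
  let f : NormalDomain.ACl A →+ NormalDomain.ACl A' :=
    QuotientAddGroup.map _ _ (NormalDomain.pullbackDiv A A') hcomap.ge
  have hf : ∀ D : NormalDomain.WeilDivisor A,
      f (QuotientAddGroup.mk D) = QuotientAddGroup.mk (NormalDomain.pullbackDiv A A' D) :=
    fun _ => rfl
  have hbij : Function.Bijective f := by
    constructor
    · rw [injective_iff_map_eq_zero]
      intro x
      induction x using QuotientAddGroup.induction_on with | H D => ?_
      rw [hf, QuotientAddGroup.eq_zero_iff, QuotientAddGroup.eq_zero_iff, ← hcomap]
      exact id
    · intro y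
      induction y using QuotientAddGroup.induction_on with | H D' => ?_
      obtain ⟨D, hD⟩ := NormalDomain.exists_linearlyEquivalent_pullbackDiv hCl D'
      refine ⟨QuotientAddGroup.mk D, ?_⟩
      rw [hf, eq_comm, QuotientAddGroup.eq_iff_sub_mem]
      exact NormalDomain.principalDivisors_le_affineTrivialDivisors hD.symm
  exact ⟨AddEquiv.ofBijective f hbij, hf⟩
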